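/- **Theorem (Trimming Threshold Selection).** Let $(Y_i,D_i,X_i)$, $i=1,2,\dots$, be i.i.d. with values in $\mathbb{R}\times\{0,1\}\times\mathbb{R}^{d}$, and let $e(X)=\mathbb{P}[D=1\mid X]$. Assume that for some $\gamma_0>1$, $$\lim_{t\downarrow 0}\frac{\mathbb{P}[e(X)\le tx]}{\mathbb{P}[e(X)\le t]}=x^{\gamma_0-1}\qquad\text{for all }x>0 .$$ For $r=1,2$ let $\mu_r(u)=\mathbb{E}[Y^r\mid e(X)=u,D=1]$ and $\mu_r(0)=\lim_{u\downarrow 0}\mu_r(u)$ (the limit being taken up to null sets of the conditional law of $e(X)$ given $D=1$), assume that these limits exist and are finite, and that $0<\mu_2(0)/\mu_1(0)^2<\infty$. Let $\hat\mu_{1}(0),\hat\mu_{2}(0)$ (depending on $n$) be estimators that converge in probability to $\mu_1(0),\mu_2(0)$ as $n\to\infty$. For a distribution function $F$ and $c\in\mathbb{R}$, say that $b>0$ *solves* $b^sF(b)=c$ if $x^sF(x)\le c$ for $0<x<b$ and $x^sF(x)\ge c$ for $x>b$. (For $c>0$ every exact solution $b>0$ is a solution in this sense. For distribution functions of laws on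 $[0,1]$ and $s,c>0$ there is exactly one solution in this sense, even where a jump of $F$ rules out an exact one.) Fix $s>0$. For all large $n$ let $b_n$ and $b_n^\dagger$ solve $$b_n^s\,\mathbb{P}[e(X)\le b_n]=\frac1{2n}\frac{\mu_2(0)}{\mu_1(0)^2},\qquad b_n^\dagger\,\mathbb{P}[e(X)\le b_n^\dagger]=\frac1{2n}\frac{\mu_2(0)}{\mu_1(0)^2},$$ and let $\hat b_n$ be random variables that, with probability tending to one, solve $$\hat b_n^s\Big(\frac1n\sum_{i=1}^n \mathbf 1\{e(X_i)\le\hat b_n\}\Big)=\frac1{2n}\frac{\hat\mu_2(0)}{\hat\mu_1(0)^2}.\tag{1}$$ Then: (a) $\hat b_n/b_n\to 1$ in probability; (b) $\hat b_n/b_n^\dagger$ converges in probability to $0$, $1$, $\infty$ if $0<s<1$, $s=1$, $s>1$, respectively. *Estimated weights.* Suppose in addition that $e(x)=e(x,\pi_0)$ for a family $e(x,\pi)$, $\pi\in\Pi\subset\mathbb{R}^k$, which is measurable in $x$ and continuously differentiable in $\pi$ on the interior of $\Pi$, that $\pi_0$ is an interior point of $\Pi$, and that $\hat\pi_n$ is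 an estimator of $\pi_0$ with the following properties. 1. $\sqrt n(\hat\pi_n-\pi_0)=n^{-1/2}\sum_{i=1}^n h(D_i,X_i)+o_{\mathrm p}(1)$ for a measurable $h$ such that $h(D,X)$ has mean zero and finite variance. 2. $\mathbb{E}\big[\sup_{|\pi-\pi_0|\le\epsilon}\big|\frac{e(X)}{e(X,\pi)^2}\frac{\partial e(X,\pi)}{\partial\pi}\big|\big]<\infty$ for some $\epsilon>0$ for which the closed ball of radius $\epsilon$ around $\pi_0$ lies in the interior of $\Pi$. 3. For every $\epsilon>0$, $$\max_{1\le i\le n}\ \sup_{|\pi-\pi_0|\le\epsilon/\sqrt n}\Big|\frac1{e(X_i)}\frac{\partial e(X_i,\pi)}{\partial\pi}\Big|=o_{\mathrm p}\Big(\sqrt{\tfrac{n}{\log n}}\Big).$$ Then (a) and (b) also hold when $e(X_i)$ is replaced by $e(X_i,\hat\pi_n)$ in (1). -/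

import Mathlib

open MeasureTheory ProbabilityTheory Filter Topology Set
open scoped ENNReal

noncomputable section

/-- `b` solves `b ^ s * F b = c` for a distribution function `F`, in the sense of generalized
inverses: `x ^ s * F x` is at most `c` to the left of `b` and at least `c` to the right of `b`.
For `c > 0` every exact solution is a solution in this sense
(`IsTrimmingThreshold.of_eq`), there is always one (`IsTrimmingThreshold.exists`), even where a
jump of `F` rules out an exact one, and there is only one (`IsTrimmingThreshold.unique`). -/
def IsTrimmingThreshold (s : ℝ) (F : ℝ → ℝ) (c b : ℝ) : Prop :=
  0 < b ∧ (∀ x, 0 < x → x < b → x ^ s * F x ≤ c) ∧ ∀ x, b < x → c ≤ x ^ s * F x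

theorem IsTrimmingThreshold.of_eq {s : ℝ} (hs : 0 < s) {F : ℝ → ℝ} (hF : Monotone F)
    (hF0 : ∀ x, 0 ≤ F x) {c b : ℝ} (hb : 0 < b) (h : b ^ s * F b = c) :
    IsTrimmingThreshold s F c b := by
  refine ⟨hb, fun x hx hxb => ?_, fun x hx => ?_⟩
  · rw [← h]
    exact mul_le_mul (Real.rpow_le_rpow hx.le hxb.le hs.le) (hF hxb.le) (hF0 x)
      (Real.rpow_nonneg hb.le s)
  · rw [← h]
    exact mul_le_mul (Real.rpow_le_rpow hb.le hx.le hs.le) (hF hx.le) (hF0 b)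
      (Real.rpow_nonneg (hb.le.trans hx.le) s)

theorem IsTrimmingThreshold.unique {s : ℝ} (hs : 0 < s) {F : ℝ → ℝ} (hF : Monotone F)
    {c b b' : ℝ} (hc : 0 < c) (h : IsTrimmingThreshold s F c b)
    (h' : IsTrimmingThreshold s F c b') : b = b' := by
  have key : ∀ u v : ℝ, IsTrimmingThreshold s F c u → IsTrimmingThreshold s F c v → ¬ u < v := by
    intro u v hu hv huv
    obtain ⟨x, hux, hxv⟩ := exists_between huv
    obtain ⟨y, hxy, hyv⟩ := exists_between hxv
    have hx0 : 0 < x := hu.1.trans hux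
    have h1 := hu.2.2 x hux
    have h2 := hv.2.1 y (hx0.trans hxy) hyv
    have hFx : 0 < F x := pos_of_mul_pos_right (hc.trans_le h1) (Real.rpow_nonneg hx0.le s)
    have h3 : x ^ s * F x < y ^ s * F y :=
      mul_lt_mul (Real.rpow_lt_rpow hx0.le hxy hs) (hF hxy.le) hFx
        (Real.rpow_nonneg (hx0.trans hxy).le s)
    linarith
  rcases lt_trichotomy b b' with hlt | heq | hlt
  · exact absurd hlt (key _ _ h h')
  · exact heq
  · exact absurd hlt (key _ _ h' h)

theorem IsTrimmingThreshold.exists {s : ℝ} (hs : 0 < s) {F : ℝ → ℝ} (hF : Monotone F)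
    (hF0 : ∀ x, 0 ≤ F x) (hF1 : ∀ x, F x ≤ 1) (hF2 : ∀ x, 1 ≤ x → F x = 1) {c : ℝ} (hc : 0 < c) :
    ∃ b, IsTrimmingThreshold s F c b := by
  have hinv : (c ^ s⁻¹) ^ s = c := Real.rpow_inv_rpow hc.le hs.ne'
  have hpos : 0 < c ^ s⁻¹ := Real.rpow_pos_of_pos hc _
  set A : Set ℝ := {x | 0 < x ∧ c ≤ x ^ s * F x} with hA
  have hlow : ∀ x ∈ A, c ^ s⁻¹ ≤ x := by
    rintro x ⟨hx, hxc⟩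
    by_contra hlt
    have h1 := Real.rpow_lt_rpow hx.le (not_le.mp hlt) hs
    have h2 : x ^ s * F x ≤ x ^ s * 1 :=
      mul_le_mul_of_nonneg_left (hF1 x) (Real.rpow_nonneg hx.le s)
    linarith
  have hne : A.Nonempty := by
    refine ⟨max 1 (c ^ s⁻¹), lt_max_of_lt_left one_pos, ?_⟩
    rw [hF2 _ (le_max_left _ _), mul_one]
    calc c = (c ^ s⁻¹) ^ s := hinv.symm
      _ ≤ _ := Real.rpow_le_rpow hpos.le (le_max_right _ _) hs.le
  have hbdd : BddBelow A := ⟨_, hlow⟩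
  refine ⟨sInf A, hpos.trans_le (le_csInf hne hlow), fun x hx hxb => ?_, fun x hx => ?_⟩
  · by_contra hlt
    exact absurd (csInf_le hbdd ⟨hx, (not_le.mp hlt).le⟩) (not_le.mpr hxb)
  · obtain ⟨y, ⟨hy, hyc⟩, hyx⟩ := exists_lt_of_csInf_lt hne hx
    exact hyc.trans (mul_le_mul (Real.rpow_le_rpow hy.le hyx.le hs.le) (hF hyx.le) (hF0 y)
      (Real.rpow_nonneg (hy.trans hyx).le s))

/-- The empirical distribution function of the `n` numbers `w 0, …, w (n - 1)`. -/
def empiricalCDF (n : ℕ) (w : ℕ → ℝ) (x : ℝ) : ℝ :=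
  (((Finset.range n).filter fun i => w i ≤ x).card : ℝ) / n

variable {Ω : Type*} [MeasurableSpace Ω]

/-- `(Y i, D i, X i)`, `i = 0, 1, 2, …`, is a random sample (independent and identically
distributed), and `e` is the probability weight: `e (X) = P[D = 1 | X]`. -/
structure IsIPWSample {d : ℕ} (P : Measure Ω) (Y : ℕ → Ω → ℝ) (D : ℕ → Ω → Bool)
    (X : ℕ → Ω → EuclideanSpace ℝ (Fin d)) (e : EuclideanSpace ℝ (Fin d) → ℝ) : Prop where
  measurable_Y : ∀ i, Measurable (Y i)
  measurable_D : ∀ i, Measurable (D i)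
  measurable_X : ∀ i, Measurable (X i)
  measurable_e : Measurable e
  indep : iIndepFun (fun i ω => (Y i ω, D i ω, X i ω)) P
  ident : ∀ i, IdentDistrib (fun ω => (Y i ω, D i ω, X i ω)) (fun ω => (Y 0 ω, D 0 ω, X 0 ω)) P P
  weight : (fun ω => e (X 0 ω)) =ᵐ[P]
    P[(D 0 ⁻¹' {true}).indicator (fun _ => (1 : ℝ)) | MeasurableSpace.comap (X 0) inferInstance]

/-- Regular variation at zero, with index `γ₀ - 1`, of the distribution function `F`. -/
def RegularlyVaryingAtZero (γ₀ : ℝ) (F : ℝ → ℝ) : Prop :=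
  ∀ x, 0 < x → Tendsto (fun t => F (t * x) / F t) (𝓝[>] 0) (𝓝 (x ^ (γ₀ - 1)))

/-- The conditional law of `Y` given `W = w` and `D = 1`. -/
def condLawTreated (P : Measure Ω) [IsProbabilityMeasure P] (Y : Ω → ℝ) (D : Ω → Bool) (W : Ω → ℝ) :
    Kernel ℝ ℝ :=
  condDistrib Y W (P[|D ⁻¹' {true}])

/-- `m = μ_r(0)`, where `μ_r(w) = E[Y ^ r | W = w, D = 1]` and `μ_r(0)` is the limit of `μ_r(w)` as
`w ↓ 0`. As `μ_r` is only determined up to null sets of the law of `W` given `D = 1`, the limit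
disregards such null sets. -/
def IsCondMomentAtZero (P : Measure Ω) [IsProbabilityMeasure P] (Y : Ω → ℝ) (D : Ω → Bool)
    (W : Ω → ℝ) (r : ℕ) (m : ℝ) : Prop :=
  (∀ᶠ w in 𝓝[>] 0 ⊓ ae ((P[|D ⁻¹' {true}]).map W),
      Integrable (fun y : ℝ => y ^ r) (condLawTreated P Y D W w)) ∧
    Tendsto (fun w => ∫ y, y ^ r ∂(condLawTreated P Y D W w))
      (𝓝[>] 0 ⊓ ae ((P[|D ⁻¹' {true}]).map W)) (𝓝 m)

/-- With probability tending to one, `bhat n` solves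
`b ^ s * (1/n) * ∑_{i ≤ n} 1(W_{n,i} ≤ b) = μ₂ / (2 n μ₁ ^ 2)`, where `W n i` are the (possibly
estimated) probability weights and `m1hat n`, `m2hat n` the estimates of `μ₁`, `μ₂`. -/
def IsEmpiricalThreshold (P : Measure Ω) (s : ℝ) (W : ℕ → ℕ → Ω → ℝ) (m1hat m2hat : ℕ → Ω → ℝ)
    (bhat : ℕ → Ω → ℝ) : Prop :=
  Tendsto (fun n => P {ω | ¬ IsTrimmingThreshold s (empiricalCDF n fun i => W n i ω)
    (1 / (2 * n) * (m2hat n ω / m1hat n ω ^ 2)) (bhat n ω)}) atTop (𝓝 0)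

/-- First-step estimation: `w x π`, `π ∈ Par`, is a parametric model of the probability weights with
true parameter `π₀`, estimated by `πhat n`, an asymptotically linear estimator with influence
function `h`, and an integrability condition. The derivative with respect to `π` is
`fderiv ℝ (w x) π`. -/
structure FirstStep {d k : ℕ} (P : Measure Ω) (D : ℕ → Ω → Bool)
    (X : ℕ → Ω → EuclideanSpace ℝ (Fin d)) (e : EuclideanSpace ℝ (Fin d) → ℝ)
    (Par : Set (EuclideanSpace ℝ (Fin k)))
    (w : EuclideanSpace ℝ (Fin d) → EuclideanSpace ℝ (Fin k) → ℝ)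
    (π₀ : EuclideanSpace ℝ (Fin k)) (πhat : ℕ → Ω → EuclideanSpace ℝ (Fin k))
    (h : Bool × EuclideanSpace ℝ (Fin d) → EuclideanSpace ℝ (Fin k)) : Prop where
  true_weight : ∀ x, w x π₀ = e x
  measurable_w : ∀ π ∈ Par, Measurable fun x => w x π
  mem_interior : π₀ ∈ interior Par
  contDiff : ∀ x, ContDiffOn ℝ 1 (w x) (interior Par)
  measurable_h : Measurable h
  memLp_h : MemLp (fun ω => h (D 0 ω, X 0 ω)) 2 P
  mean_h : ∫ ω, h (D 0 ω, X 0 ω) ∂P = 0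
  linear : TendstoInMeasure P
    (fun (n : ℕ) ω => √(n : ℝ) • (πhat n ω - π₀) -
      (1 / √(n : ℝ)) • ∑ i ∈ Finset.range n, h (D i ω, X i ω)) atTop (fun _ => 0)
  integrable_sup : ∃ ε > 0, Metric.closedBall π₀ ε ⊆ interior Par ∧
    ∫⁻ ω, (⨆ π ∈ Metric.closedBall π₀ ε,
      ‖w (X 0 ω) π₀‖ₑ / ‖w (X 0 ω) π‖ₑ ^ 2 * ‖fderiv ℝ (w (X 0 ω)) π‖ₑ) ∂P < ∞

/-- For every `ε > 0`, the maximum over `i ≤ n` of the suprema over `|π - π₀| ≤ ε / √n` of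
`|(1 / e(X_i)) ∂e(X_i, π)/∂π|` is `o_p(√(n / log n))`. -/
def UniformRate {d k : ℕ} (P : Measure Ω) (X : ℕ → Ω → EuclideanSpace ℝ (Fin d))
    (w : EuclideanSpace ℝ (Fin d) → EuclideanSpace ℝ (Fin k) → ℝ)
    (π₀ : EuclideanSpace ℝ (Fin k)) : Prop :=
  ∀ ε > 0, ∀ δ > 0, Tendsto (fun n : ℕ => P {ω | ENNReal.ofReal (δ * √(n / Real.log n)) ≤
    ⨆ i ∈ Finset.range n, ⨆ π ∈ Metric.closedBall π₀ (ε / √(n : ℝ)),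
      ‖fderiv ℝ (w (X i ω)) π‖ₑ / ‖w (X i ω) π₀‖ₑ}) atTop (𝓝 0)

/-- `bhat n / b n → 1` in probability, and `bhat n / bdag n` tends in probability to `0`, `1`, `∞`
for `s < 1`, `s = 1`, `s > 1`. -/
def ThresholdConsistency (P : Measure Ω) (s : ℝ) (b bdag : ℕ → ℝ) (bhat : ℕ → Ω → ℝ) : Prop :=
  TendstoInMeasure P (fun n ω => bhat n ω / b n) atTop (fun _ => 1) ∧
  (s < 1 → TendstoInMeasure P (fun n ω => bhat n ω / bdag n) atTop (fun _ => 0)) ∧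
  (s = 1 → TendstoInMeasure P (fun n ω => bhat n ω / bdag n) atTop (fun _ => 1)) ∧
  (1 < s → ∀ M : ℝ, Tendsto (fun n => P {ω | bhat n ω / bdag n ≤ M}) atTop (𝓝 0))

end

/-! Let `F` be the distribution function of the weight and `r = m2 / m1 ^ 2`. The thresholds `b n`
tend to zero, and `n * b n ^ s * F (b n)` is of constant order up to the slack in the definition of
a solution. By regular variation `n * F (p * b n)` therefore tends to infinity for each fixed `p >
0` (`IsTrimmingThreshold.tendsto_inv_mul`). Since this is the expected number of observations below
`p * b n`, Chebyshev's inequality makes the empirical distribution function relatively accurate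
there.

No uniform control of the empirical process is needed: monotonicity of `x ^ s * F x` locates the
solution once the empirical distribution function is controlled at two points, `ρ ^ 2 * b n` and
`ρ⁻¹ ^ 2 * b n`. The growth of `x ^ s` absorbs the errors of the empirical distribution function and
of the estimated level, so the empirical threshold lies between `ρ⁻¹ ^ 3 * b n` and `ρ ^ 3 * b n`
(`tendsto_measure_not_threshold_bounds`). Letting `ρ` decrease to `1` gives (a).

For (b), regular variation compares the deterministic thresholds with exponents `s` and `1` at the
same level (`IsTrimmingThreshold.tendsto_div`).

Estimated weights change the argument only through an extra factor `ρ`: by the mean value inequality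
on a ball of radius of order `1 / √n`, their relative error is uniformly small over the sample
(`FirstStep.tendsto_measure_relative_error`). -/

/-! ### Regularly varying distribution functions and trimming thresholds -/

section Deterministic

variable {γ₀ : ℝ} {F : ℝ → ℝ}

/-- With ratio argument `1` the limit is `1`, while `F t / F t` is `0` wherever `F t = 0`. Hence `F`
is nonzero at points arbitrarily close to zero. -/
theorem RegularlyVaryingAtZero.pos (h : RegularlyVaryingAtZero γ₀ F) (hF : Monotone F)
    (hF0 : ∀ x, 0 ≤ F x) {x : ℝ} (hx : 0 < x) : 0 < F x := by
  have h1 := h 1 one_pos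
  rw [Real.one_rpow] at h1
  have h2 : ∀ᶠ t in 𝓝[>] (0 : ℝ), 0 < F (t * 1) / F t := h1.eventually_const_lt one_pos
  have h3 : ∀ᶠ t in 𝓝[>] (0 : ℝ), t < x := eventually_nhdsWithin_of_eventually_nhds (gt_mem_nhds hx)
  obtain ⟨t, ht, htx⟩ := (h2.and h3).exists
  have h4 : F t ≠ 0 := by
    rintro h0
    simp [h0] at ht
  exact ((hF0 t).lt_of_ne' h4).trans_le (hF htx.le)

/-- If `F 0` were positive, the right limit of `F` at zero would be positive and `F (t / 2) / F t`
would tend to `1`, not to `(1 / 2) ^ (γ₀ - 1) < 1`. -/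
theorem RegularlyVaryingAtZero.apply_zero (h : RegularlyVaryingAtZero γ₀ F) (hγ : 1 < γ₀)
    (hF : Monotone F) (hF0 : ∀ x, 0 ≤ F x) : F 0 = 0 := by
  by_contra hne
  have hpos : 0 < F 0 := (hF0 0).lt_of_ne' hne
  set L := sInf (F '' Ioi 0)
  have hL : Tendsto F (𝓝[>] 0) (𝓝 L) := hF.tendsto_nhdsGT 0
  have hLpos : 0 < L := hpos.trans_le <| ge_of_tendsto hL <|
    eventually_nhdsWithin_of_forall fun t ht => hF (le_of_lt ht)
  have hhalf : Tendsto (fun t : ℝ => t * (1 / 2)) (𝓝[>] 0) (𝓝[>] 0) := by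
    refine tendsto_nhdsWithin_iff.2 ⟨?_, ?_⟩
    · have : Tendsto (fun t : ℝ => t * (1 / 2)) (𝓝 0) (𝓝 (0 * (1 / 2))) :=
        tendsto_id.mul_const _
      rw [zero_mul] at this
      exact this.mono_left nhdsWithin_le_nhds
    · exact eventually_nhdsWithin_of_forall fun t (ht : 0 < t) => mul_pos ht (by norm_num)
  have h1 : Tendsto (fun t => F (t * (1 / 2)) / F t) (𝓝[>] 0) (𝓝 (L / L)) :=
    (hL.comp hhalf).div hL hLpos.ne'
  have h2 := tendsto_nhds_unique h1 (h (1 / 2) (by norm_num))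
  rw [div_self hLpos.ne'] at h2
  exact (Real.rpow_lt_one (by norm_num) (by norm_num) (sub_pos.2 hγ)).ne h2.symm

/-- Thresholds for levels tending to zero tend to zero from the right. -/
theorem IsTrimmingThreshold.tendsto_zero {s : ℝ} (h : RegularlyVaryingAtZero γ₀ F)
    (hF : Monotone F) (hF0 : ∀ x, 0 ≤ F x) {c b : ℕ → ℝ} (hc : Tendsto c atTop (𝓝 0))
    (hb : ∀ᶠ n in atTop, IsTrimmingThreshold s F (c n) (b n)) : Tendsto b atTop (𝓝[>] 0) := by
  refine tendsto_nhdsWithin_iff.2 ⟨?_, hb.mono fun n hn => hn.1⟩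
  refine tendsto_order.2 ⟨fun a ha => hb.mono fun n hn => ha.trans hn.1, fun a ha => ?_⟩
  have ha2 : 0 < a / 2 := half_pos ha
  have hpos : 0 < (a / 2) ^ s * F (a / 2) := mul_pos (Real.rpow_pos_of_pos ha2 s) (h.pos hF hF0 ha2)
  filter_upwards [hb, hc.eventually_lt_const hpos] with n hn hcn
  by_contra hab
  exact absurd (hn.2.1 (a / 2) ha2 ((half_lt_self ha).trans_le (not_lt.1 hab))) (not_le.2 hcn)

theorem RegularlyVaryingAtZero.tendsto_ratio (h : RegularlyVaryingAtZero γ₀ F) {b : ℕ → ℝ}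
    (hb : Tendsto b atTop (𝓝[>] 0)) {p q : ℝ} (hp : 0 < p) (hq : 0 < q) :
    Tendsto (fun n => F (p * b n) / F (q * b n)) atTop (𝓝 ((p / q) ^ (γ₀ - 1))) := by
  have hqb : Tendsto (fun n => q * b n) atTop (𝓝[>] 0) := by
    rw [tendsto_nhdsWithin_iff] at hb ⊢
    refine ⟨by simpa using hb.1.const_mul q, hb.2.mono fun n hn => mul_pos hq hn⟩
  refine ((h (p / q) (div_pos hp hq)).comp hqb).congr fun n => ?_
  simp only [Function.comp]
  congr 2
  field_simp

/-- At a fixed multiple of the threshold the expected number of observations is unbounded. -/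
theorem IsTrimmingThreshold.tendsto_inv_mul {s r : ℝ} (h : RegularlyVaryingAtZero γ₀ F)
    (hF : Monotone F) (hF0 : ∀ x, 0 ≤ F x) (hs : 0 < s) (hr : 0 < r) {b : ℕ → ℝ}
    (hb : ∀ᶠ n : ℕ in atTop, IsTrimmingThreshold s F (1 / (2 * n) * r) (b n))
    (hb0 : Tendsto b atTop (𝓝[>] 0)) {p : ℝ} (hp : 0 < p) :
    Tendsto (fun n : ℕ => 1 / (n * F (p * b n))) atTop (𝓝 0) := by
  -- Half the limit of `F (p * b n) / F (2 * b n)`. The point `2 * b n` appears because the lower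
  -- threshold inequality holds only strictly to the right of `b n`.
  set κ : ℝ := (p / 2) ^ (γ₀ - 1) / 2
  have hlim : 0 < (p / 2) ^ (γ₀ - 1) := Real.rpow_pos_of_pos (half_pos hp) _
  have hκ : 0 < κ := half_pos hlim
  have hratio := (h.tendsto_ratio hb0 hp two_pos).eventually_const_lt (half_lt_self hlim)
  have hub : Tendsto (fun n => (2 / (κ * r)) * (2 * b n) ^ s) atTop (𝓝 0) := by
    have h1 : Tendsto (fun n => 2 * b n) atTop (𝓝 0) := by
      simpa using (tendsto_nhdsWithin_iff.1 hb0).1.const_mul 2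
    have h2 := (h1.rpow_const (p := s) (Or.inr hs.le)).const_mul (2 / (κ * r))
    simpa [Real.zero_rpow hs.ne'] using h2
  refine squeeze_zero' (Eventually.of_forall fun n => ?_) ?_ hub
  · exact div_nonneg zero_le_one (mul_nonneg n.cast_nonneg (hF0 _))
  filter_upwards [hb, hratio, eventually_gt_atTop 0] with n hn hrn hn0
  have hnr : (0 : ℝ) < n := Nat.cast_pos.2 hn0
  have hbn := hn.1
  have hF2 : 0 < F (2 * b n) := h.pos hF hF0 (by positivity)
  have hFp : 0 < F (p * b n) := h.pos hF hF0 (by positivity)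
  have h1 := hn.2.2 (2 * b n) (by linarith)
  have h2 : κ * F (2 * b n) < F (p * b n) := (lt_div_iff₀ hF2).1 hrn
  have hB : 0 < (2 * b n) ^ s := Real.rpow_pos_of_pos (by positivity) s
  have h3 : κ * r ≤ 2 * (2 * b n) ^ s * (n * F (p * b n)) := by
    have h4 : r ≤ 2 * n * ((2 * b n) ^ s * F (2 * b n)) := by
      calc r = 2 * n * (1 / (2 * n) * r) := by field_simp
        _ ≤ _ := mul_le_mul_of_nonneg_left h1 (by positivity)
    calc κ * r ≤ κ * (2 * n * ((2 * b n) ^ s * F (2 * b n))) :=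
          mul_le_mul_of_nonneg_left h4 hκ.le
      _ = 2 * (2 * b n) ^ s * n * (κ * F (2 * b n)) := by ring
      _ ≤ 2 * (2 * b n) ^ s * n * F (p * b n) :=
          mul_le_mul_of_nonneg_left h2.le (by positivity)
      _ = _ := by ring
  rw [div_mul_eq_mul_div, div_le_div_iff₀ (by positivity) (by positivity)]
  linarith

/-- Of two thresholds for the same levels, the one with the smaller exponent is negligible. -/
theorem IsTrimmingThreshold.tendsto_div {s t : ℝ} (h : RegularlyVaryingAtZero γ₀ F)
    (hF : Monotone F) (hF0 : ∀ x, 0 ≤ F x) (hst : s < t) {c b b' : ℕ → ℝ}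
    (hb : ∀ᶠ n in atTop, IsTrimmingThreshold s F (c n) (b n))
    (hb' : ∀ᶠ n in atTop, IsTrimmingThreshold t F (c n) (b' n))
    (hb0 : Tendsto b' atTop (𝓝[>] 0)) {δ : ℝ} (hδ : 0 < δ) :
    ∀ᶠ n in atTop, b n ≤ δ * b' n := by
  have hratio := (h.tendsto_ratio hb0 two_pos hδ).eventually_lt_const (lt_add_one _)
  -- An eventual bound for `F (2 * b' n) / F (δ * b' n)`. If `b n` exceeded `δ * b' n`, the
  -- threshold inequalities at `δ * b' n` and `2 * b' n` would give `δ ^ s ≤ 2 ^ t * K * b' n ^ (t -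
  -- s)`, whose right side tends to zero.
  set K : ℝ := (2 / δ) ^ (γ₀ - 1) + 1
  have hub : Tendsto (fun n => 2 ^ t * K * b' n ^ (t - s)) atTop (𝓝 0) := by
    have h2 := (((tendsto_nhdsWithin_iff.1 hb0).1).rpow_const (p := t - s)
      (Or.inr (sub_pos.2 hst).le)).const_mul (2 ^ t * K)
    simpa [Real.zero_rpow (sub_pos.2 hst).ne'] using h2
  filter_upwards [hb, hb', hratio, hub.eventually_lt_const (Real.rpow_pos_of_pos hδ s)]
    with n hn hn' hrn hun
  by_contra hlt
  have hbn := hn'.1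
  have h1 := hn.2.1 (δ * b' n) (by positivity) (not_le.1 hlt)
  have h2 := hn'.2.2 (2 * b' n) (by linarith)
  have hFδ : 0 < F (δ * b' n) := h.pos hF hF0 (by positivity)
  have h3 : F (2 * b' n) < K * F (δ * b' n) := (div_lt_iff₀ hFδ).1 hrn
  have hbs : 0 < b' n ^ s := Real.rpow_pos_of_pos hbn s
  have h4 : δ ^ s * (b' n ^ s * F (δ * b' n)) ≤
      2 ^ t * K * b' n ^ (t - s) * (b' n ^ s * F (δ * b' n)) := by
    calc δ ^ s * (b' n ^ s * F (δ * b' n)) = (δ * b' n) ^ s * F (δ * b' n) := by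
          rw [Real.mul_rpow hδ.le hbn.le]; ring
      _ ≤ (2 * b' n) ^ t * F (2 * b' n) := h1.trans h2
      _ ≤ (2 * b' n) ^ t * (K * F (δ * b' n)) :=
          mul_le_mul_of_nonneg_left h3.le (Real.rpow_nonneg (by positivity) t)
      _ = 2 ^ t * (b' n ^ (t - s) * b' n ^ s) * (K * F (δ * b' n)) := by
          rw [Real.mul_rpow two_pos.le hbn.le, ← Real.rpow_add hbn, sub_add_cancel]
      _ = _ := by ring
  exact absurd (le_of_mul_le_mul_right h4 (mul_pos hbs hFδ)) (not_le.2 hun)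

end Deterministic

/-! ### Events of vanishing probability -/

section Probability

variable {Ω : Type*} [MeasurableSpace Ω] {P : Measure Ω}

theorem tendsto_measure_zero_mono {A B : ℕ → Set Ω} (hB : Tendsto (fun n => P (B n)) atTop (𝓝 0))
    (h : ∀ᶠ n in atTop, A n ⊆ B n) : Tendsto (fun n => P (A n)) atTop (𝓝 0) :=
  tendsto_of_tendsto_of_tendsto_of_le_of_le' tendsto_const_nhds hB
    (Eventually.of_forall fun _ => zero_le) (h.mono fun _ hn => measure_mono hn)

theorem tendsto_measure_zero_union {A B : ℕ → Set Ω}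
    (hA : Tendsto (fun n => P (A n)) atTop (𝓝 0)) (hB : Tendsto (fun n => P (B n)) atTop (𝓝 0)) :
    Tendsto (fun n => P (A n ∪ B n)) atTop (𝓝 0) := by
  have h := hA.add hB
  rw [add_zero] at h
  exact tendsto_of_tendsto_of_tendsto_of_le_of_le tendsto_const_nhds h
    (fun _ => zero_le) (fun _ => measure_union_le _ _)

/-- Chebyshev's inequality for a sum of independent random variables. -/
theorem measure_abs_sum_sub_ge_le [IsProbabilityMeasure P] {g : ℕ → Ω → ℝ} {m V : ℝ}
    (hL : ∀ i, MemLp (g i) 2 P) (hind : iIndepFun g P) (hm : ∀ i, ∫ ω, g i ω ∂P = m)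
    (hV : ∀ i, Var[g i; P] ≤ V) (n : ℕ) {c : ℝ} (hc : 0 < c) :
    P {ω | c ≤ |∑ i ∈ Finset.range n, g i ω - n * m|} ≤ ENNReal.ofReal (n * V / c ^ 2) := by
  have h1 := meas_ge_le_variance_div_sq (memLp_finsetSum' (Finset.range n) fun i _ => hL i) hc
  have h2 : ∫ ω, (∑ i ∈ Finset.range n, g i) ω ∂P = n * m := by
    simp only [Finset.sum_apply]
    rw [integral_finsetSum _ fun i _ => (hL i).integrable one_le_two]
    simp [hm]
  have h3 : Var[∑ i ∈ Finset.range n, g i; P] ≤ n * V := by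
    rw [IndepFun.variance_sum (fun i _ => hL i) fun i _ j _ hij => hind.indepFun hij]
    calc _ ≤ ∑ i ∈ Finset.range n, V := Finset.sum_le_sum fun i _ => hV i
      _ = n * V := by simp
  rw [h2] at h1
  simp only [Finset.sum_apply] at h1
  exact h1.trans (ENNReal.ofReal_le_ofReal (div_le_div_of_nonneg_right h3 (sq_nonneg c)))

/-- Relative deviations of the empirical distribution function from the distribution function. -/
theorem measure_empiricalCDF_deviation_le [IsProbabilityMeasure P] {Z : ℕ → Ω → ℝ}
    (hZ : ∀ i, Measurable (Z i)) (hind : iIndepFun Z P)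
    (hid : ∀ i, IdentDistrib (Z i) (Z 0) P P) {x η : ℝ} (hη : 0 < η)
    (hx : 0 < P.real {ω | Z 0 ω ≤ x}) {n : ℕ} (hn : 0 < n) :
    P {ω | η * P.real {ω | Z 0 ω ≤ x} ≤
        |empiricalCDF n (fun i => Z i ω) x - P.real {ω | Z 0 ω ≤ x}|} ≤
      ENNReal.ofReal (1 / η ^ 2 * (1 / (n * P.real {ω | Z 0 ω ≤ x}))) := by
  set p := P.real {ω | Z 0 ω ≤ x}
  set φ : ℝ → ℝ := (Iic x).indicator 1 with hφ_def
  have hφ : Measurable φ := measurable_one.indicator measurableSet_Iic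
  have hφb : ∀ y, φ y = 0 ∨ φ y = 1 := fun y => by
    by_cases hy : y ∈ Iic x <;> simp [hφ_def, hy]
  have hL : ∀ i, MemLp (φ ∘ Z i) 2 P := fun i => by
    refine MemLp.of_bound (hφ.comp (hZ i)).aestronglyMeasurable 1 (ae_of_all _ fun ω => ?_)
    rcases hφb (Z i ω) with h | h <;> simp [h]
  have hm : ∀ i, ∫ ω, (φ ∘ Z i) ω ∂P = p := fun i => by
    rw [((hid i).comp hφ).integral_eq]
    exact integral_indicator_one (hZ 0 measurableSet_Iic)
  -- An indicator equals its square, so its second moment is its mean. A variance bound proportional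
  -- to `p` is what makes the relative error small once `n * p` is large.
  have hV : ∀ i, Var[φ ∘ Z i; P] ≤ p := fun i => by
    refine (variance_le_expectation_sq (hφ.comp (hZ i)).aestronglyMeasurable).trans_eq ?_
    rw [← hm i]
    refine integral_congr_ae (ae_of_all _ fun ω => ?_)
    rcases hφb (Z i ω) with h | h <;> simp [h]
  have hnr : (0 : ℝ) < n := Nat.cast_pos.2 hn
  have hcheb := measure_abs_sum_sub_ge_le hL (hind.comp (fun _ => φ) fun _ => hφ) hm hV n
    (c := n * (η * p)) (by positivity)
  have hsum : ∀ ω, empiricalCDF n (fun i => Z i ω) x =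
      (∑ i ∈ Finset.range n, (φ ∘ Z i) ω) / n := fun ω => by
    rw [empiricalCDF, Finset.card_filter]
    push_cast
    rfl
  refine (measure_mono fun ω hω => ?_).trans (hcheb.trans_eq ?_)
  · simp only [mem_ofPred_eq, hsum] at hω ⊢
    have : ∑ i ∈ Finset.range n, (φ ∘ Z i) ω - n * p =
        n * ((∑ i ∈ Finset.range n, (φ ∘ Z i) ω) / n - p) := by field_simp
    rw [this, abs_mul, abs_of_pos hnr]
    exact mul_le_mul_of_nonneg_left hω hnr.le
  · congr 1
    field_simp

/-- Normalized sums of independent, identically distributed, centred, square integrable vectors are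
bounded in probability. -/
theorem exists_measure_norm_sum_ge_le [IsProbabilityMeasure P] {k : ℕ}
    {H : ℕ → Ω → EuclideanSpace ℝ (Fin k)} (hind : iIndepFun H P)
    (hid : ∀ i, IdentDistrib (H i) (H 0) P P) (hL : MemLp (H 0) 2 P) (hm : ∫ ω, H 0 ω ∂P = 0)
    {η : ℝ≥0∞} (hη : 0 < η) :
    ∃ K : ℝ, 0 < K ∧ ∀ n : ℕ, 0 < n →
      P {ω | K ≤ ‖(1 / √(n : ℝ)) • ∑ i ∈ Finset.range n, H i ω‖} ≤ η := by
  have hproj : ∀ j : Fin k, Measurable fun v : EuclideanSpace ℝ (Fin k) => v j :=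
    fun j => (EuclideanSpace.proj (𝕜 := ℝ) j).continuous.measurable
  set g : Fin k → ℕ → Ω → ℝ := fun j i ω => H i ω j
  have hgid : ∀ j i, IdentDistrib (g j i) (g j 0) P P := fun j i => (hid i).comp (hproj j)
  have hgL : ∀ j i, MemLp (g j i) 2 P := fun j i => (hgid j i).symm.memLp_snd (hL.eval_piLp j)
  have hgm : ∀ j i, ∫ ω, g j i ω ∂P = 0 := fun j i => by
    rw [(hgid j i).integral_eq]
    have := (EuclideanSpace.proj (𝕜 := ℝ) j).integral_comp_comm (hL.integrable one_le_two)
    rw [hm, map_zero] at this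
    exact this
  set V : ℝ := ∑ j, Var[g j 0; P]
  have hV0 : 0 ≤ V := Finset.sum_nonneg fun j _ => variance_nonneg _ _
  obtain ⟨M, hM, hMη⟩ : ∃ M : ℝ, 0 < M ∧ ENNReal.ofReal (V / M ^ 2) ≤ η := by
    have h1 : Tendsto (fun M : ℝ => ENNReal.ofReal (V / M ^ 2)) atTop (𝓝 0) := by
      rw [← ENNReal.ofReal_zero]
      exact ENNReal.tendsto_ofReal
        (tendsto_const_nhds.div_atTop (tendsto_pow_atTop two_ne_zero))
    obtain ⟨M, hM, hM'⟩ := ((h1.eventually_le_const hη).and (eventually_gt_atTop 0)).exists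
    exact ⟨M, hM', hM⟩
  -- The norm is at most the sum of the `k` absolute coordinates; `k + 1` keeps the inequality
  -- strict and the constant positive when `k = 0`.
  refine ⟨M * (k + 1), by positivity, fun n hn => ?_⟩
  have hnr : (0 : ℝ) < n := Nat.cast_pos.2 hn
  have hsq : 0 < √(n : ℝ) := Real.sqrt_pos.2 hnr
  have hsub : {ω | M * (k + 1) ≤ ‖(1 / √(n : ℝ)) • ∑ i ∈ Finset.range n, H i ω‖} ⊆
      ⋃ j ∈ (Finset.univ : Finset (Fin k)),
        {ω | √n * M ≤ |∑ i ∈ Finset.range n, g j i ω - n * 0|} := by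
    intro ω hω
    simp only [mem_ofPred_eq] at hω
    by_contra hcon
    simp only [Finset.mem_univ, iUnion_true, mem_iUnion, mem_ofPred_eq, not_exists, not_le,
      mul_zero, sub_zero] at hcon
    set v := ∑ i ∈ Finset.range n, H i ω
    have hv : ∀ j, v j = ∑ i ∈ Finset.range n, g j i ω := fun j =>
      map_sum (EuclideanSpace.proj (𝕜 := ℝ) j) (fun i => H i ω) (Finset.range n)
    have h1 : ‖v‖ ≤ ∑ j, |v j| := by
      conv_lhs => rw [← (EuclideanSpace.basisFun (Fin k) ℝ).sum_repr v]
      refine (norm_sum_le _ _).trans_eq (Finset.sum_congr rfl fun j _ => ?_)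
      rw [norm_smul, (EuclideanSpace.basisFun (Fin k) ℝ).norm_eq_one]
      simp
    have h2 : ∑ j, |v j| ≤ k * (√n * M) := by
      calc _ ≤ ∑ j : Fin k, √n * M := Finset.sum_le_sum fun j _ => by rw [hv]; exact (hcon j).le
        _ = _ := by simp
    rw [norm_smul, Real.norm_of_nonneg (by positivity), one_div, ← div_eq_inv_mul,
      le_div_iff₀ hsq] at hω
    have h3 : 0 < √n * M := by positivity
    nlinarith
  refine (measure_mono hsub).trans <| (measure_biUnion_finset_le _ _).trans <| le_trans ?_ hMη
  calc _ ≤ ∑ j : Fin k, ENNReal.ofReal (Var[g j 0; P] / M ^ 2) :=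
        Finset.sum_le_sum fun j _ => by
          have hi : iIndepFun (g j) P := hind.comp (fun _ v => v j) fun _ => hproj j
          refine (measure_abs_sum_sub_ge_le (hgL j) hi (hgm j)
            (fun i => ((hgid j i).variance_eq).le) n (c := √n * M) (by positivity)).trans_eq ?_
          congr 1
          rw [mul_pow, Real.sq_sqrt hnr.le]
          field_simp
    _ = _ := by
        rw [← ENNReal.ofReal_sum_of_nonneg fun j _ => div_nonneg (variance_nonneg _ _)
          (sq_nonneg M), ← Finset.sum_div]

end Probability

/-! ### Comparison of empirical and population thresholds -/

theorem empiricalCDF_le_empiricalCDF {n : ℕ} {w z : ℕ → ℝ} {x y : ℝ}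
    (h : ∀ i < n, w i ≤ x → z i ≤ y) : empiricalCDF n w x ≤ empiricalCDF n z y := by
  unfold empiricalCDF
  refine div_le_div_of_nonneg_right (Nat.cast_le.2 (Finset.card_le_card fun i hi => ?_))
    n.cast_nonneg
  simp only [Finset.mem_filter, Finset.mem_range] at hi ⊢
  exact ⟨hi.1, h i hi.1 hi.2⟩

/-- Passing from `ρ * b` to `ρ ^ 3 * b` multiplies the power by `ρ ^ (2 * s) = q ^ 4`, and replacing
`F` by `G` costs one factor `q`. A larger `b'` would thus force `q ^ 3 * c ≤ c'`, beyond the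
tolerance `q ^ 2` for the level. In the application `a` is the empirical distribution function of
the true weights, and `G` that of the estimated ones. -/
theorem IsTrimmingThreshold.le_of_perturbation {s ρ q c c' b b' : ℝ} {F G : ℝ → ℝ} {a : ℝ}
    (hρ : 1 < ρ) (hq : 1 < q) (hqs : q ^ 2 = ρ ^ s) (hc : 0 < c) (hF : Monotone F)
    (hb : IsTrimmingThreshold s F c b) (hb' : IsTrimmingThreshold s G c' b')
    (hc' : c' < q ^ 2 * c) (ha : q⁻¹ * F (ρ ^ 2 * b) ≤ a) (haG : a ≤ G (ρ ^ 3 * b)) :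
    b' ≤ ρ ^ 3 * b := by
  by_contra hlt
  have hb0 := hb.1
  have hρ0 : 0 < ρ := by linarith
  have hq0 : 0 < q := by linarith
  have h1 := hb'.2.1 (ρ ^ 3 * b) (by positivity) (not_le.1 hlt)
  have h2 := hb.2.2 (ρ * b) (by nlinarith)
  have h3 : F (ρ * b) ≤ F (ρ ^ 2 * b) := hF (by nlinarith [mul_pos hρ0 hb0])
  have hpow : (ρ ^ 3 * b) ^ s = q ^ 4 * (ρ * b) ^ s := by
    rw [show ρ ^ 3 * b = ρ ^ 2 * (ρ * b) by ring, Real.mul_rpow (by positivity) (by positivity),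
      ← Real.rpow_pow_comm hρ0.le, ← hqs]
    ring
  have hB : 0 < (ρ * b) ^ s := Real.rpow_pos_of_pos (by positivity) s
  have h4 : q ^ 3 * c ≤ c' := by
    calc q ^ 3 * c ≤ q ^ 3 * ((ρ * b) ^ s * F (ρ * b)) :=
          mul_le_mul_of_nonneg_left h2 (by positivity)
      _ ≤ q ^ 3 * ((ρ * b) ^ s * F (ρ ^ 2 * b)) := by gcongr
      _ = q ^ 4 * (ρ * b) ^ s * (q⁻¹ * F (ρ ^ 2 * b)) := by field_simp
      _ ≤ q ^ 4 * (ρ * b) ^ s * G (ρ ^ 3 * b) :=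
          mul_le_mul_of_nonneg_left (ha.trans haG) (by positivity)
      _ ≤ c' := by rw [← hpow]; exact h1
  have h5 : q ^ 2 * c ≤ q ^ 3 * c :=
    mul_le_mul_of_nonneg_right (pow_le_pow_right₀ hq.le (by norm_num)) hc.le
  linarith

/-- The mirror image: the power loses `q ^ 4`, the change of distribution function returns at most
`q`, and `c' ≤ (q ^ 3)⁻¹ * c` contradicts the tolerance. -/
theorem IsTrimmingThreshold.ge_of_perturbation {s ρ q c c' b b' : ℝ} {F G : ℝ → ℝ} {a : ℝ}
    (hρ : 1 < ρ) (hq : 1 < q) (hqs : q ^ 2 = ρ ^ s) (hc : 0 < c) (hF : Monotone F)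
    (hb : IsTrimmingThreshold s F c b) (hb' : IsTrimmingThreshold s G c' b')
    (hc' : (q ^ 2)⁻¹ * c < c') (ha : a ≤ q * F (ρ⁻¹ ^ 2 * b)) (haG : G (ρ⁻¹ ^ 3 * b) ≤ a) :
    ρ⁻¹ ^ 3 * b ≤ b' := by
  by_contra hlt
  have hb0 := hb.1
  have hρ0 : 0 < ρ := by linarith
  have hρi : 0 < ρ⁻¹ := inv_pos.2 hρ0
  have hρi1 : ρ⁻¹ < 1 := inv_lt_one_of_one_lt₀ hρ
  have hq0 : 0 < q := by linarith
  have h1 := hb'.2.2 (ρ⁻¹ ^ 3 * b) (not_le.1 hlt)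
  have h2 := hb.2.1 (ρ⁻¹ * b) (by positivity) (by nlinarith)
  have h3 : F (ρ⁻¹ ^ 2 * b) ≤ F (ρ⁻¹ * b) := hF (by nlinarith [mul_pos hρi hb0])
  have hpow : (ρ⁻¹ ^ 3 * b) ^ s = (q ^ 4)⁻¹ * (ρ⁻¹ * b) ^ s := by
    rw [show ρ⁻¹ ^ 3 * b = ρ⁻¹ ^ 2 * (ρ⁻¹ * b) by ring,
      Real.mul_rpow (by positivity) (by positivity), ← Real.rpow_pow_comm hρi.le,
      Real.inv_rpow hρ0.le, ← hqs]
    ring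
  have hB : 0 < (ρ⁻¹ * b) ^ s := Real.rpow_pos_of_pos (by positivity) s
  have h4 : c' ≤ (q ^ 3)⁻¹ * c := by
    calc c' ≤ (q ^ 4)⁻¹ * (ρ⁻¹ * b) ^ s * G (ρ⁻¹ ^ 3 * b) := by rw [← hpow]; exact h1
      _ ≤ (q ^ 4)⁻¹ * (ρ⁻¹ * b) ^ s * (q * F (ρ⁻¹ ^ 2 * b)) :=
          mul_le_mul_of_nonneg_left (haG.trans ha) (by positivity)
      _ = (q ^ 3)⁻¹ * ((ρ⁻¹ * b) ^ s * F (ρ⁻¹ ^ 2 * b)) := by field_simp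
      _ ≤ (q ^ 3)⁻¹ * ((ρ⁻¹ * b) ^ s * F (ρ⁻¹ * b)) := by gcongr
      _ ≤ _ := mul_le_mul_of_nonneg_left h2 (by positivity)
  have h5 : (q ^ 3)⁻¹ * c ≤ (q ^ 2)⁻¹ * c :=
    mul_le_mul_of_nonneg_right
      (inv_anti₀ (by positivity) (pow_le_pow_right₀ hq.le (by norm_num))) hc.le
  linarith

/-! ### Consistency of empirical thresholds -/

section Consistency

variable {Ω : Type*} [MeasurableSpace Ω] {P : Measure Ω} [IsProbabilityMeasure P]
  {Z : ℕ → Ω → ℝ} {γ₀ s r : ℝ} {b : ℕ → ℝ}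

theorem monotone_measureReal_le (Z : Ω → ℝ) : Monotone fun x => P.real {ω | Z ω ≤ x} :=
  fun _ _ hxy => measureReal_mono fun _ hω => le_trans hω hxy

theorem tendsto_level (r : ℝ) : Tendsto (fun n : ℕ => 1 / (2 * (n : ℝ)) * r) atTop (𝓝 0) := by
  have h := (tendsto_one_div_atTop_nhds_zero_nat (𝕜 := ℝ)).const_mul (r / 2)
  rw [mul_zero] at h
  refine h.congr fun n => ?_
  rw [one_div, one_div, mul_inv]
  ring

/-- With probability tending to one, empirical thresholds computed from relatively uniformly
consistent weights lie between fixed multiples of the population thresholds. -/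
theorem tendsto_measure_not_threshold_bounds (hZ : ∀ i, Measurable (Z i)) (hind : iIndepFun Z P)
    (hid : ∀ i, IdentDistrib (Z i) (Z 0) P P)
    (htail : RegularlyVaryingAtZero γ₀ fun x => P.real {ω | Z 0 ω ≤ x}) (hs : 0 < s) (hr : 0 < r)
    (hb : ∀ᶠ n : ℕ in atTop, IsTrimmingThreshold s (fun x => P.real {ω | Z 0 ω ≤ x})
      (1 / (2 * n) * r) (b n))
    {rhat : ℕ → Ω → ℝ} (hrhat : ∀ ε > 0, Tendsto (fun n => P {ω | ε ≤ |rhat n ω - r|}) atTop (𝓝 0))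
    {W : ℕ → ℕ → Ω → ℝ}
    (hW : ∀ δ > 0, Tendsto (fun n => P {ω | ∃ i < n, δ * Z i ω < |W n i ω - Z i ω|}) atTop (𝓝 0))
    {bhat : ℕ → Ω → ℝ}
    (hbhat : Tendsto (fun n : ℕ => P {ω | ¬ IsTrimmingThreshold s
      (empiricalCDF n fun i => W n i ω) (1 / (2 * n) * rhat n ω) (bhat n ω)}) atTop (𝓝 0))
    {ρ : ℝ} (hρ : 1 < ρ) :
    Tendsto (fun n => P {ω | ¬ (ρ⁻¹ ^ 3 * b n ≤ bhat n ω ∧ bhat n ω ≤ ρ ^ 3 * b n)})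
      atTop (𝓝 0) := by
  set F : ℝ → ℝ := fun x => P.real {ω | Z 0 ω ≤ x} with hF_def
  have hF : Monotone F := monotone_measureReal_le (Z 0)
  have hF0 : ∀ x, 0 ≤ F x := fun x => measureReal_nonneg
  have hb0 := IsTrimmingThreshold.tendsto_zero htail hF hF0 (tendsto_level r) hb
  have hρ0 : 0 < ρ := by linarith
  have hρi : 0 < ρ⁻¹ := inv_pos.2 hρ0
  set q : ℝ := ρ ^ (s / 2)
  have hq : 1 < q := Real.one_lt_rpow hρ (half_pos hs)
  have hq0 : 0 < q := by linarith
  have hqs : q ^ 2 = ρ ^ s := by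
    rw [← Real.rpow_natCast, ← Real.rpow_mul hρ0.le]
    norm_num
  -- A relative error below `1 - t⁻¹` keeps a nonnegative quantity within the factors `t⁻¹` and `t`;
  -- the upper factor uses `t + t⁻¹ ≥ 2`.
  have aux : ∀ t : ℝ, 1 < t → 0 < 1 - t⁻¹ ∧ 2 - t⁻¹ ≤ t := fun t ht => by
    have ht0 : 0 < t := by linarith
    refine ⟨sub_pos.2 (inv_lt_one_of_one_lt₀ ht), ?_⟩
    have h1 : t * t⁻¹ = 1 := mul_inv_cancel₀ ht0.ne'
    nlinarith [mul_nonneg (inv_pos.2 ht0).le (sq_nonneg (t - 1))]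
  have hdev : ∀ p : ℝ, 0 < p → Tendsto (fun n : ℕ => P {ω | (1 - q⁻¹) * F (p * b n) ≤
      |empiricalCDF n (fun i => Z i ω) (p * b n) - F (p * b n)|}) atTop (𝓝 0) := fun p hp => by
    have h1 := ENNReal.tendsto_ofReal
      ((IsTrimmingThreshold.tendsto_inv_mul htail hF hF0 hs hr hb hb0 hp).const_mul
        (1 / (1 - q⁻¹) ^ 2))
    rw [mul_zero, ENNReal.ofReal_zero] at h1
    refine tendsto_of_tendsto_of_tendsto_of_le_of_le' tendsto_const_nhds h1
      (Eventually.of_forall fun _ => zero_le) ?_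
    filter_upwards [hb, eventually_gt_atTop 0] with n hn hn0
    exact measure_empiricalCDF_deviation_le hZ hind hid (aux q hq).1
      (RegularlyVaryingAtZero.pos htail hF hF0 (mul_pos hp hn.1)) hn0
  have hq2 : 1 < q ^ 2 := one_lt_pow₀ hq two_ne_zero
  have hρ' := aux ρ hρ
  have hq' := aux q hq
  have hqq' := aux (q ^ 2) hq2
  refine tendsto_measure_zero_mono (tendsto_measure_zero_union hbhat <|
    tendsto_measure_zero_union (hrhat ((1 - (q ^ 2)⁻¹) * r) (mul_pos hqq'.1 hr)) <|
    tendsto_measure_zero_union (hW (1 - ρ⁻¹) hρ'.1) <|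
    tendsto_measure_zero_union (hdev (ρ ^ 2) (by positivity)) (hdev (ρ⁻¹ ^ 2) (by positivity))) ?_
  filter_upwards [hb, eventually_gt_atTop 0] with n hn hn0 ω hω
  by_contra hcon
  simp only [mem_union, mem_ofPred_eq, not_or, not_le, not_not, not_exists, not_and, not_lt]
    at hcon
  obtain ⟨hT, hrn, hWn, hd1, hd2⟩ := hcon
  refine hω ?_
  have hnr : (0 : ℝ) < n := Nat.cast_pos.2 hn0
  have hn2 : (0 : ℝ) < 1 / (2 * n) := by positivity
  rw [abs_lt] at hrn hd1 hd2
  have hFp : 0 ≤ F (ρ⁻¹ ^ 2 * b n) := hF0 _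
  constructor
  · refine IsTrimmingThreshold.ge_of_perturbation hρ hq hqs (mul_pos hn2 hr) hF hn hT
      ?_ (a := empiricalCDF n (fun i => Z i ω) (ρ⁻¹ ^ 2 * b n)) ?_ ?_
    · rw [mul_left_comm]
      exact mul_lt_mul_of_pos_left (by linarith) hn2
    · nlinarith
    · refine empiricalCDF_le_empiricalCDF fun i hi hWi => ?_
      have h1 := abs_le.1 (hWn i hi)
      have h2 : ρ⁻¹ * Z i ω ≤ ρ⁻¹ * (ρ⁻¹ ^ 2 * b n) := by nlinarith
      exact le_of_mul_le_mul_left h2 hρi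
  · refine IsTrimmingThreshold.le_of_perturbation hρ hq hqs (mul_pos hn2 hr) hF hn hT
      ?_ (a := empiricalCDF n (fun i => Z i ω) (ρ ^ 2 * b n)) ?_ ?_
    · rw [mul_left_comm]
      exact mul_lt_mul_of_pos_left (by nlinarith) hn2
    · linarith
    · refine empiricalCDF_le_empiricalCDF fun i hi hZi => ?_
      have h1 := abs_le.1 (hWn i hi)
      -- The error bound itself forces the sign, since it makes `(1 - ρ⁻¹) * Z i ω` dominate an
      -- absolute value.
      have h0 : 0 ≤ Z i ω := by
        have := (abs_nonneg _).trans (hWn i hi)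
        exact nonneg_of_mul_nonneg_right this hρ'.1
      nlinarith

/-- Consistency of empirical thresholds computed from relatively uniformly consistent weights. -/
theorem thresholdConsistency_of_weights (hZ : ∀ i, Measurable (Z i)) (hind : iIndepFun Z P)
    (hid : ∀ i, IdentDistrib (Z i) (Z 0) P P)
    (htail : RegularlyVaryingAtZero γ₀ fun x => P.real {ω | Z 0 ω ≤ x}) (hs : 0 < s) (hr : 0 < r)
    (hb : ∀ᶠ n : ℕ in atTop, IsTrimmingThreshold s (fun x => P.real {ω | Z 0 ω ≤ x})
      (1 / (2 * n) * r) (b n))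
    {bdag : ℕ → ℝ}
    (hbdag : ∀ᶠ n : ℕ in atTop, IsTrimmingThreshold 1 (fun x => P.real {ω | Z 0 ω ≤ x})
      (1 / (2 * n) * r) (bdag n))
    {rhat : ℕ → Ω → ℝ} (hrhat : ∀ ε > 0, Tendsto (fun n => P {ω | ε ≤ |rhat n ω - r|}) atTop (𝓝 0))
    {W : ℕ → ℕ → Ω → ℝ}
    (hW : ∀ δ > 0, Tendsto (fun n => P {ω | ∃ i < n, δ * Z i ω < |W n i ω - Z i ω|}) atTop (𝓝 0))
    {bhat : ℕ → Ω → ℝ}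
    (hbhat : Tendsto (fun n : ℕ => P {ω | ¬ IsTrimmingThreshold s
      (empiricalCDF n fun i => W n i ω) (1 / (2 * n) * rhat n ω) (bhat n ω)}) atTop (𝓝 0)) :
    ThresholdConsistency P s b bdag bhat := by
  set F : ℝ → ℝ := fun x => P.real {ω | Z 0 ω ≤ x} with hF_def
  have hF : Monotone F := monotone_measureReal_le (Z 0)
  have hF0 : ∀ x, 0 ≤ F x := fun x => measureReal_nonneg
  have hb0 := IsTrimmingThreshold.tendsto_zero htail hF hF0 (tendsto_level r) hb
  have hbdag0 := IsTrimmingThreshold.tendsto_zero htail hF hF0 (tendsto_level r) hbdag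
  have hbound := fun {ρ : ℝ} (hρ : 1 < ρ) => tendsto_measure_not_threshold_bounds hZ hind hid
    htail hs hr hb hrhat hW hbhat hρ
  have hone : TendstoInMeasure P (fun n ω => bhat n ω / b n) atTop (fun _ => 1) := by
    rw [tendstoInMeasure_iff_dist]
    intro ε hε
    have hc : Tendsto (fun ρ : ℝ => ρ ^ 3) (𝓝[>] 1) (𝓝 (1 ^ 3)) :=
      (continuous_pow 3).continuousAt.tendsto.mono_left nhdsWithin_le_nhds
    have hc' : Tendsto (fun ρ : ℝ => ρ⁻¹ ^ 3) (𝓝[>] 1) (𝓝 (1⁻¹ ^ 3)) :=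
      ((tendsto_inv₀ one_ne_zero).pow 3).mono_left nhdsWithin_le_nhds
    obtain ⟨ρ, ⟨h1, h2⟩, hρ⟩ := (((hc.eventually_lt_const (u := 1 + ε) (by linarith)).and
      (hc'.eventually_const_lt (u := 1 - ε) (by norm_num; linarith))).and
        self_mem_nhdsWithin).exists
    refine tendsto_measure_zero_mono (hbound hρ) ?_
    filter_upwards [hb] with n hn ω hω
    rintro ⟨h3, h4⟩
    have h5 := (le_div_iff₀ hn.1).2 h3
    have h6 := (div_le_iff₀ hn.1).2 h4
    rw [mem_ofPred_eq] at hω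
    refine absurd hω (not_le.2 ?_)
    rw [Real.dist_eq, abs_lt]
    constructor <;> linarith
  refine ⟨hone, fun hs1 => ?_, fun hs1 => ?_, fun hs1 M => ?_⟩
  · rw [tendstoInMeasure_iff_dist]
    intro ε hε
    -- With `ρ = 2`, `bhat n` is at most `8 * b n`, hence at most `ε / 2 * bdag n`.
    have hsmall := IsTrimmingThreshold.tendsto_div htail hF hF0 hs1 hb hbdag hbdag0
      (δ := ε / 16) (by positivity)
    refine tendsto_measure_zero_mono (hbound one_lt_two) ?_
    filter_upwards [hb, hbdag, hsmall] with n hn hn' hsn ω hω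
    rintro ⟨h3, h4⟩
    rw [mem_ofPred_eq] at hω
    refine absurd hω (not_le.2 ?_)
    have hbn := hn.1
    have hbn' := hn'.1
    rw [Real.dist_eq, sub_zero, abs_of_nonneg (div_nonneg (le_trans (by positivity) h3) hbn'.le),
      div_lt_iff₀ hbn']
    nlinarith [mul_pos hε hbn']
  · subst hs1
    refine hone.congr' ?_ (ae_eq_refl _)
    filter_upwards [hb, hbdag, eventually_gt_atTop 0] with n hn hn' hn0
    have hnr : (0 : ℝ) < n := Nat.cast_pos.2 hn0
    rw [hn.unique one_pos hF (by positivity) hn']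
  -- With `ρ = 2`, `bhat n` is at least `b n / 8`, while this `δ` gives `(|M| + 1) * bdag n ≤ b n /
  -- 16`.
  · set δ : ℝ := 1 / (16 * (|M| + 1))
    have hM : 0 < |M| + 1 := by positivity
    have hsmall := IsTrimmingThreshold.tendsto_div htail hF hF0 hs1 hbdag hb hb0
      (δ := δ) (by positivity)
    refine tendsto_measure_zero_mono (hbound one_lt_two) ?_
    filter_upwards [hb, hbdag, hsmall] with n hn hn' hsn ω hω
    rintro ⟨h3, h4⟩
    rw [mem_ofPred_eq] at hω
    refine absurd hω (not_le.2 ?_)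
    have hbn := hn.1
    have hbn' := hn'.1
    rw [lt_div_iff₀ hbn']
    have h5 : (|M| + 1) * bdag n ≤ b n / 16 := by
      calc _ ≤ (|M| + 1) * (δ * b n) := mul_le_mul_of_nonneg_left hsn hM.le
        _ = _ := by simp only [δ]; field_simp
    have h6 : M * bdag n ≤ (|M| + 1) * bdag n :=
      mul_le_mul_of_nonneg_right (by linarith [le_abs_self M]) hbn'.le
    norm_num at h3
    linarith

end Consistency

/-- The ratio `μ₂ / μ₁ ^ 2` is estimated consistently. -/
theorem tendsto_measure_moment_ratio {Ω : Type*} [MeasurableSpace Ω] {P : Measure Ω}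
    {m1 m2 : ℝ} {m1hat m2hat : ℕ → Ω → ℝ}
    (hm1hat : TendstoInMeasure P m1hat atTop fun _ => m1)
    (hm2hat : TendstoInMeasure P m2hat atTop fun _ => m2) (hm1 : m1 ≠ 0) {ε : ℝ} (hε : 0 < ε) :
    Tendsto (fun n => P {ω | ε ≤ |m2hat n ω / m1hat n ω ^ 2 - m2 / m1 ^ 2|}) atTop (𝓝 0) := by
  have hcont : ContinuousAt (fun p : ℝ × ℝ => p.2 / p.1 ^ 2) (m1, m2) :=
    continuousAt_snd.div (continuousAt_fst.pow 2) (pow_ne_zero 2 hm1)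
  obtain ⟨δ, hδ, h⟩ := Metric.continuousAt_iff.1 hcont ε hε
  refine tendsto_measure_zero_mono (tendsto_measure_zero_union
    (tendstoInMeasure_iff_dist.1 hm1hat δ hδ) (tendstoInMeasure_iff_dist.1 hm2hat δ hδ))
    (Eventually.of_forall fun n ω hω => ?_)
  by_contra hcon
  simp only [mem_union, mem_ofPred_eq, not_or, not_le] at hcon
  have h1 := @h (m1hat n ω, m2hat n ω) (by rw [Prod.dist_eq]; exact max_lt hcon.1 hcon.2)
  rw [Real.dist_eq] at h1
  exact absurd hω (not_le.2 h1)

/-! ### Estimated weights -/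

section EstimatedWeights

variable {Ω : Type*} [MeasurableSpace Ω] {P : Measure Ω} {d k : ℕ}
  {Y : ℕ → Ω → ℝ} {D : ℕ → Ω → Bool} {X : ℕ → Ω → EuclideanSpace ℝ (Fin d)}
  {e : EuclideanSpace ℝ (Fin d) → ℝ}

theorem IsIPWSample.measurable_weight (h : IsIPWSample P Y D X e) (i : ℕ) :
    Measurable fun ω => e (X i ω) :=
  h.measurable_e.comp (h.measurable_X i)

theorem IsIPWSample.iIndepFun_weight (h : IsIPWSample P Y D X e) :
    iIndepFun (fun i ω => e (X i ω)) P :=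
  h.indep.comp (fun _ p => e p.2.2) fun _ => h.measurable_e.comp (by fun_prop)

theorem IsIPWSample.identDistrib_weight (h : IsIPWSample P Y D X e) (i : ℕ) :
    IdentDistrib (fun ω => e (X i ω)) (fun ω => e (X 0 ω)) P P :=
  (h.ident i).comp (u := fun p : ℝ × Bool × EuclideanSpace ℝ (Fin d) => e p.2.2)
    (h.measurable_e.comp (measurable_snd.comp measurable_snd))

variable [IsProbabilityMeasure P]

/-- Almost surely all weights are positive. -/
theorem IsIPWSample.measure_weight_nonpos {γ₀ : ℝ} (h : IsIPWSample P Y D X e) (hγ : 1 < γ₀)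
    (htail : RegularlyVaryingAtZero γ₀ fun x => P.real {ω | e (X 0 ω) ≤ x}) :
    P {ω | ∃ i, e (X i ω) ≤ 0} = 0 := by
  have h0 : P.real {ω | e (X 0 ω) ≤ 0} = 0 :=
    htail.apply_zero hγ (monotone_measureReal_le _) fun _ => measureReal_nonneg
  have : {ω | ∃ i, e (X i ω) ≤ 0} = ⋃ i, {ω | e (X i ω) ≤ 0} := by ext; simp
  rw [this, measure_iUnion_null_iff]
  intro i
  exact ((h.identDistrib_weight i).measure_mem_eq (s := Iic 0) measurableSet_Iic).trans
    ((measureReal_eq_zero_iff (measure_ne_top P _)).1 h0)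

/-- The estimated weights are relatively uniformly consistent. -/
theorem FirstStep.tendsto_measure_relative_error {γ₀ : ℝ} (hsample : IsIPWSample P Y D X e)
    (hγ : 1 < γ₀) (htail : RegularlyVaryingAtZero γ₀ fun x => P.real {ω | e (X 0 ω) ≤ x})
    {Par : Set (EuclideanSpace ℝ (Fin k))}
    {w : EuclideanSpace ℝ (Fin d) → EuclideanSpace ℝ (Fin k) → ℝ}
    {π₀ : EuclideanSpace ℝ (Fin k)} {πhat : ℕ → Ω → EuclideanSpace ℝ (Fin k)}
    {h : Bool × EuclideanSpace ℝ (Fin d) → EuclideanSpace ℝ (Fin k)}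
    (hfs : FirstStep P D X e Par w π₀ πhat h) (hrate : UniformRate P X w π₀) {δ : ℝ} (hδ : 0 < δ) :
    Tendsto (fun n => P {ω | ∃ i < n, δ * e (X i ω) < |w (X i ω) (πhat n ω) - e (X i ω)|})
      atTop (𝓝 0) := by
  have hu : Measurable fun p : ℝ × Bool × EuclideanSpace ℝ (Fin d) => h p.2 :=
    hfs.measurable_h.comp measurable_snd
  rw [ENNReal.tendsto_nhds_zero]
  intro η hη
  have hη2 : 0 < η / 2 := ENNReal.half_pos hη.ne'
  obtain ⟨K, hK, hKη⟩ := exists_measure_norm_sum_ge_le (P := P) (H := fun i ω => h (D i ω, X i ω))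
    (hsample.indep.comp (fun _ p => h p.2) fun _ => hu) (fun i => (hsample.ident i).comp hu)
    hfs.memLp_h hfs.mean_h hη2
  obtain ⟨R, hR, hRPar⟩ := Metric.isOpen_iff.1 isOpen_interior π₀ hfs.mem_interior
  have hK1 : 0 < K + 1 := by positivity
  -- In the radius `(K + 1) / √n`, `K` bounds the normalized influence sum and `1` the linearization
  -- remainder. The rate constant `δ / (K + 1)` cancels the numerator in the mean value inequality.
  have hsmall := tendsto_measure_zero_union
    (tendstoInMeasure_iff_norm.1 hfs.linear 1 one_pos) <| tendsto_measure_zero_union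
      (hrate (K + 1) hK1 (δ / (K + 1)) (by positivity))
      (tendsto_const_nhds_iff.2 (hsample.measure_weight_nonpos hγ htail))
  have hball : Tendsto (fun n : ℕ => (K + 1) / √(n : ℝ)) atTop (𝓝 0) :=
    tendsto_const_nhds.div_atTop
      (Real.tendsto_sqrt_atTop.comp tendsto_natCast_atTop_atTop)
  filter_upwards [hsmall.eventually_le_const hη2, hball.eventually_lt_const hR,
    eventually_ge_atTop 3] with n hn hRn hn3
  rw [← ENNReal.add_halves η]
  refine le_trans (measure_mono ?_) <| (measure_union_le _ _).trans
    (add_le_add (hKη n (by omega)) hn)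
  rintro ω ⟨i, hi, hlt⟩
  by_contra hcon
  simp only [mem_union, mem_ofPred_eq, not_or, not_le, not_exists, sub_zero] at hcon
  obtain ⟨h1, h2, h3, h4⟩ := hcon
  have hnr : (0 : ℝ) < n := by positivity
  have hsq : 0 < √(n : ℝ) := Real.sqrt_pos.2 hnr
  have hdist : ‖πhat n ω - π₀‖ ≤ (K + 1) / √n := by
    rw [le_div_iff₀ hsq, mul_comm, ← Real.norm_of_nonneg hsq.le, ← norm_smul]
    calc _ = ‖(√(n : ℝ) • (πhat n ω - π₀) - (1 / √(n : ℝ)) •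
          ∑ i ∈ Finset.range n, h (D i ω, X i ω)) + (1 / √(n : ℝ)) •
          ∑ i ∈ Finset.range n, h (D i ω, X i ω)‖ := by rw [sub_add_cancel]
      _ ≤ 1 + K := (norm_add_le _ _).trans (add_le_add h2.le h1.le)
      _ = _ := add_comm _ _
  have he : 0 < e (X i ω) := h4 i
  -- From `n ≥ 3 > exp 1` the logarithm is at least `1`.
  have hsqrt : √(n / Real.log n) ≤ √n := by
    refine Real.sqrt_le_sqrt (div_le_self hnr.le ?_)
    rw [Real.le_log_iff_exp_le hnr]
    exact Real.exp_one_lt_three.le.trans (by exact_mod_cast hn3)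
  have hderiv : ∀ π ∈ Metric.closedBall π₀ ((K + 1) / √(n : ℝ)),
      ‖fderiv ℝ (w (X i ω)) π‖ ≤ δ / (K + 1) * √n * e (X i ω) := fun π hπ => by
    have h5 : ‖fderiv ℝ (w (X i ω)) π‖ₑ / ‖w (X i ω) π₀‖ₑ <
        ENNReal.ofReal (δ / (K + 1) * √(n / Real.log n)) :=
      lt_of_le_of_lt (le_iSup₂_of_le i (Finset.mem_range.2 hi) (le_iSup₂
        (f := fun π _ => ‖fderiv ℝ (w (X i ω)) π‖ₑ / ‖w (X i ω) π₀‖ₑ) π hπ)) h3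
    rw [hfs.true_weight, Real.enorm_of_nonneg he.le,
      ENNReal.div_lt_iff (Or.inl (ENNReal.ofReal_pos.2 he).ne') (Or.inl ENNReal.ofReal_ne_top),
      ← ENNReal.ofReal_mul (by positivity), ← ofReal_norm] at h5
    refine ((ENNReal.ofReal_lt_ofReal_iff_of_nonneg (norm_nonneg _)).1 h5).le.trans ?_
    gcongr
  have hdiff : ∀ π ∈ Metric.closedBall π₀ ((K + 1) / √(n : ℝ)),
      DifferentiableAt ℝ (w (X i ω)) π := fun π hπ =>
    ((hfs.contDiff (X i ω)).differentiableOn one_ne_zero).differentiableAt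
      (isOpen_interior.mem_nhds (hRPar (Metric.closedBall_subset_ball hRn hπ)))
  have hmv := Convex.norm_image_sub_le_of_norm_fderiv_le hdiff hderiv (convex_closedBall _ _)
    (Metric.mem_closedBall_self (by positivity)) (mem_closedBall_iff_norm.2 hdist)
  rw [hfs.true_weight, Real.norm_eq_abs] at hmv
  refine absurd (hmv.trans ?_) (not_le.2 hlt)
  calc _ ≤ δ / (K + 1) * √n * e (X i ω) * ((K + 1) / √n) :=
        mul_le_mul_of_nonneg_left hdist (by positivity)
    _ = δ * e (X i ω) := by field_simp

end EstimatedWeights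

/-! ### True and estimated weights -/

theorem mainTheorem3 {Ω : Type*} [MeasurableSpace Ω] (P : Measure Ω) [IsProbabilityMeasure P]
    {d : ℕ} (Y : ℕ → Ω → ℝ) (D : ℕ → Ω → Bool) (X : ℕ → Ω → EuclideanSpace ℝ (Fin d))
    (e : EuclideanSpace ℝ (Fin d) → ℝ) (hsample : IsIPWSample P Y D X e)
    (γ₀ : ℝ) (hγ₀ : 1 < γ₀)
    (htail : RegularlyVaryingAtZero γ₀ fun x => P.real {ω | e (X 0 ω) ≤ x})
    (m1 m2 : ℝ)
    (hm1 : IsCondMomentAtZero P (Y 0) (D 0) (fun ω => e (X 0 ω)) 1 m1)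
    (hm2 : IsCondMomentAtZero P (Y 0) (D 0) (fun ω => e (X 0 ω)) 2 m2)
    (hm1_ne : m1 ≠ 0) (hm2_pos : 0 < m2)
    (m1hat m2hat : ℕ → Ω → ℝ)
    (hm1hat : TendstoInMeasure P m1hat atTop fun _ => m1)
    (hm2hat : TendstoInMeasure P m2hat atTop fun _ => m2)
    (s : ℝ) (hs : 0 < s) (b bdag : ℕ → ℝ)
    (hb : ∀ᶠ n : ℕ in atTop, IsTrimmingThreshold s (fun x => P.real {ω | e (X 0 ω) ≤ x})
      (1 / (2 * n) * (m2 / m1 ^ 2)) (b n))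
    (hbdag : ∀ᶠ n : ℕ in atTop, IsTrimmingThreshold 1 (fun x => P.real {ω | e (X 0 ω) ≤ x})
      (1 / (2 * n) * (m2 / m1 ^ 2)) (bdag n)) :
    (∀ bhat : ℕ → Ω → ℝ,
      IsEmpiricalThreshold P s (fun _ i ω => e (X i ω)) m1hat m2hat bhat →
        ThresholdConsistency P s b bdag bhat) ∧
    (∀ (k : ℕ) (Par : Set (EuclideanSpace ℝ (Fin k)))
      (w : EuclideanSpace ℝ (Fin d) → EuclideanSpace ℝ (Fin k) → ℝ)
      (π₀ : EuclideanSpace ℝ (Fin k)) (πhat : ℕ → Ω → EuclideanSpace ℝ (Fin k))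
      (h : Bool × EuclideanSpace ℝ (Fin d) → EuclideanSpace ℝ (Fin k)),
      FirstStep P D X e Par w π₀ πhat h → UniformRate P X w π₀ →
      ∀ bhat : ℕ → Ω → ℝ,
        IsEmpiricalThreshold P s (fun n i ω => w (X i ω) (πhat n ω)) m1hat m2hat bhat →
          ThresholdConsistency P s b bdag bhat) := by
  have hr : 0 < m2 / m1 ^ 2 := by positivity
  have hpos := hsample.measure_weight_nonpos hγ₀ htail
  have main : ∀ W : ℕ → ℕ → Ω → ℝ, (∀ δ > 0, Tendsto (fun n =>
      P {ω | ∃ i < n, δ * e (X i ω) < |W n i ω - e (X i ω)|}) atTop (𝓝 0)) →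
      ∀ bhat : ℕ → Ω → ℝ, IsEmpiricalThreshold P s W m1hat m2hat bhat →
        ThresholdConsistency P s b bdag bhat := fun W hW bhat hbhat =>
    thresholdConsistency_of_weights (Z := fun i ω => e (X i ω)) hsample.measurable_weight
      hsample.iIndepFun_weight hsample.identDistrib_weight htail hs hr hb hbdag
      (fun ε hε => tendsto_measure_moment_ratio hm1hat hm2hat hm1_ne hε) hW hbhat
  refine ⟨main _ fun δ hδ => ?_, fun k Par w π₀ πhat h hfs hrate => main _ fun δ hδ =>
    hfs.tendsto_measure_relative_error hsample hγ₀ htail hrate hδ⟩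
  -- The true weights have error zero, so the exceptional event requires a negative weight and is
  -- null.
  refine tendsto_measure_zero_mono (tendsto_const_nhds_iff.2 hpos)
    (Eventually.of_forall fun n ω => ?_)
  rintro ⟨i, -, hi⟩
  refine ⟨i, ?_⟩
  rw [sub_self, abs_zero] at hi
  exact (neg_of_mul_neg_right hi hδ.le).le
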